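/- There is an absolute constant $K$ such that the following holds for all integers $n\ge 1$ and $1\le d\le 2^n$. Let $q_0,\dots,q_{d-1}\in\{0,1\}^n$ be distinct, let $\alpha_0,\dots,\alpha_{d-1}\in\mathbb{C}$ satisfy $\sum_{i}|\alpha_i|^2=1$, and let $|\phi\rangle=\sum_{i=0}^{d-1}\alpha_i|q_i\rangle$ be the corresponding $n$-qubit $d$-sparse state. Then there are an integer $0\le m\le Kd$ and a quantum circuit on $n+m$ qubits ($n$ qubits and $m$ ancilla qubits), built from arbitrary one-qubit unitary gates (elements of $U(2)$) and CNOT gates, without measurements, that maps $|0\rangle^{\otimes n}|0\rangle^{\otimes m}$ exactly to $|\phi\rangle|0\rangle^{\otimes m}$ and has size (number of gates) at most $K\,d\,n$ and depth (number of layers of gates acting on pairwise disjoint qubits) at most $K\,n\max(1,\log_2 d)$. That is, over the gate set $\{U(2),\mathrm{CNOT}\}$ every $n$-qubit $d$-sparse state can be prepared by a circuit of size $O(dn)$ and depth $O(n\log d)$ (read as $O(n)$ if $d=1$) with $O(d)$ ancilla qubits. -/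

import Mathlib

namespace SQSP

/-- The (unnormalized) pure states of a register of qubits labelled by `ι`: a vector of complex
amplitudes, one for each computational basis state `x : ι → Fin 2`. -/
abbrev QState (ι : Type) : Type := (ι → Fin 2) → ℂ

section

variable {ι κ : Type}

/-- The computational basis state `|x⟩`. -/
def ket [DecidableEq (ι → Fin 2)] (x : ι → Fin 2) : QState ι := Pi.single x 1

/-- The tensor product `ψ ⊗ χ` of the states of two registers. -/
def tensor (ψ : QState ι) (χ : QState κ) : QState (ι ⊕ κ) :=
  fun x => ψ (fun i => x (Sum.inl i)) * χ (fun j => x (Sum.inr j))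

/-- The `n`-qubit state `∑ i, α i |q i⟩` with `d` prescribed amplitudes. -/
noncomputable def sparseState {n d : ℕ} (α : Fin d → ℂ) (q : Fin d → (Fin n → Fin 2)) :
    QState (Fin n) :=
  ∑ i, α i • ket (q i)

/-- An elementary gate from the gate set `{U(2), CNOT}`, placed on specific qubits. -/
inductive Gate (ι : Type) : Type where
  /-- a one-qubit gate: an arbitrary `2 × 2` unitary matrix `U` on the qubit `i` -/
  | single (i : ι) (U : Matrix.unitaryGroup (Fin 2) ℂ) : Gate ι
  /-- the controlled-NOT gate with control qubit `c` and target qubit `t` -/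
  | cnot (c t : ι) (h : c ≠ t) : Gate ι

/-- The set of the qubits that a gate acts on. -/
def Gate.qubits : Gate ι → Set ι
  | .single i _ => {i}
  | .cnot c t _ => {c, t}

/-- The action of a gate on states. `single i U` applies the matrix `U` to the `i`-th tensor
factor. `cnot c t` maps `|x⟩` to `|x'⟩`, where `x'` is `x` with its bit `t` replaced by the sum
modulo 2 of the bits `t` and `c`; this permutation of the basis states is its own inverse. -/
noncomputable def Gate.apply [DecidableEq ι] : Gate ι → QState ι → QState ι
  | .single i U, ψ => fun x =>
      ∑ b : Fin 2, (U : Matrix (Fin 2) (Fin 2) ℂ) (x i) b * ψ (Function.update x i b)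
  | .cnot c t _, ψ => fun x => ψ (Function.update x t (x t + x c))

/-- A layer: finitely many gates that act on pairwise disjoint sets of qubits (so that they can be
executed at the same time, and their order does not matter). -/
structure Layer (ι : Type) : Type where
  gates : List (Gate ι)
  disjoint : gates.Pairwise fun g h => Disjoint g.qubits h.qubits

/-- The action of a layer on states. -/
noncomputable def Layer.apply [DecidableEq ι] (L : Layer ι) (ψ : QState ι) : QState ι :=
  L.gates.foldl (fun φ g => g.apply φ) ψ

/-- A quantum circuit over the gate set `{U(2), CNOT}`: a sequence of layers, the first layer of
the list being executed first. -/
structure Circuit (ι : Type) : Type where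
  layers : List (Layer ι)

/-- The size of a circuit: its number of elementary gates. -/
def Circuit.size (C : Circuit ι) : ℕ := (C.layers.map fun L => L.gates.length).sum

/-- The depth of a circuit: its number of layers. -/
def Circuit.depth (C : Circuit ι) : ℕ := C.layers.length

/-- The action of a circuit on states. -/
noncomputable def Circuit.run [DecidableEq ι] (C : Circuit ι) (ψ : QState ι) : QState ι :=
  C.layers.foldl (fun φ L => L.apply φ) ψ

/-- A circuit on `n` qubits and `m` ancilla qubits prepares the `n`-qubit state `ψ` if it maps
`|0⟩^{⊗ n} ⊗ |0⟩^{⊗ m}` to `ψ ⊗ |0⟩^{⊗ m}`. -/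
def Circuit.Prepares {n m : ℕ} (C : Circuit (Fin n ⊕ Fin m)) (ψ : QState (Fin n)) : Prop :=
  C.run (tensor (ket 0) (ket 0)) = tensor ψ (ket 0)

end

end SQSP

/-!
The circuit works with a one-hot encoding. Besides the `n` data qubits it has `d` node qubits and
`d` copy qubits as ancillas, and it passes through the states
`|0⟩|0⟩ → ∑ i, α i |0⟩|e_i⟩ → ∑ i, α i |q i⟩|e_i⟩ → ∑ i, α i |q i⟩|0⟩`, where `e_i` is the one-hot
encoding of `i` in the node qubits.

The first and the last step use the binary trie of the bit strings `q i`. A node at depth `k` of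
the trie, a class of strings with the same first `k` bits, is represented by its least index
`rep q k i`; so a node shares its node qubit with one of its children, and the other child, if there
is one, brings in a new node qubit. At each depth the pairs (node, new child) are disjoint, and can
be treated in parallel by gadgets of constant size.

* `maps_oneHot`: going down the trie, the weight of each node is split between its two children
  (`exists_split_weight`, a controlled reflection followed by a CNOT). The phases of the `α i` are
  inserted at the end.
* `maps_write`: each bit of `q i` is a parity of node qubits, which a CNOT tree of depth
  `O(log d)` computes (`maps_parity`).
* `maps_erase`: going up the trie, the position of the one-hot encoding moves from the nodes at
  depth `k + 1` to their parents. The data bit `k` tells from which of the two children it came, so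
  this is a reversible operation; a CNOT tree copies that bit to all copy qubits before, and
  uncopies it afterwards (`maps_fanout`), so that the gadgets (`exists_merge`) run in parallel.

Each depth of the trie and each parity costs size `O(d)` and depth `O(log d)`, and there are
`O(n)` of them.

All gadgets are controlled reflections and CNOTs. A real reflection is a conjugate of NOT by a
rotation, so controlled reflections are easily built (`exists_controlled_reflect`), and their action
is computed on states that are a product of one target qubit and a basis state of the other qubits
(`spread`).
-/

namespace SQSP

/-! ### Gate sequences and circuits -/

section Semantics

variable {ι τ υ : Type} [DecidableEq ι]

/-- The action of a gate as a linear map. -/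
noncomputable def Gate.lin (g : Gate ι) : QState ι →ₗ[ℂ] QState ι where
  toFun := g.apply
  map_add' ψ χ := by
    cases g <;> funext x
    · simp only [Gate.apply, Pi.add_apply, mul_add, Finset.sum_add_distrib]
    · rfl
  map_smul' c ψ := by
    cases g <;> funext x
    · simp only [Gate.apply, Pi.smul_apply, smul_eq_mul, Finset.mul_sum, RingHom.id_apply,
        mul_left_comm]
    · rfl

/-- The action of a sequence of gates, the first gate of the list being executed first. -/
noncomputable def runGates : List (Gate ι) → QState ι →ₗ[ℂ] QState ι
  | [] => LinearMap.id
  | g :: l => runGates l ∘ₗ g.lin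

@[simp] lemma runGates_nil (ψ : QState ι) : runGates [] ψ = ψ := rfl

lemma runGates_cons (g : Gate ι) (l : List (Gate ι)) (ψ : QState ι) :
    runGates (g :: l) ψ = runGates l (g.apply ψ) := rfl

lemma runGates_append (l l' : List (Gate ι)) (ψ : QState ι) :
    runGates (l ++ l') ψ = runGates l' (runGates l ψ) := by
  induction l generalizing ψ with
  | nil => rfl
  | cons g l ih => simp [runGates_cons, ih]

lemma Layer.apply_eq_runGates (L : Layer ι) (ψ : QState ι) : L.apply ψ = runGates L.gates ψ := by
  unfold Layer.apply
  generalize L.gates = l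
  induction l generalizing ψ with
  | nil => rfl
  | cons g l ih => simp [runGates_cons, ih]

lemma Circuit.run_eq_runGates (C : Circuit ι) (ψ : QState ι) :
    C.run ψ = runGates (C.layers.flatMap Layer.gates) ψ := by
  unfold Circuit.run
  generalize C.layers = l
  induction l generalizing ψ with
  | nil => rfl
  | cons L l ih =>
    rw [List.foldl_cons, ih, List.flatMap_cons, runGates_append, Layer.apply_eq_runGates]

/-- Some circuit of size at most `s` and depth at most `p` maps `ψ i` to `ψ' i` for every `i`. -/
def Maps (s p : ℕ) (ψ ψ' : τ → QState ι) : Prop :=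
  ∃ C : Circuit ι, (∀ i, C.run (ψ i) = ψ' i) ∧ C.size ≤ s ∧ C.depth ≤ p

lemma Maps.mono {s p s' p' : ℕ} {ψ ψ' : τ → QState ι} (h : Maps s p ψ ψ') (hs : s ≤ s')
    (hp : p ≤ p') : Maps s' p' ψ ψ' := by
  obtain ⟨C, h, h1, h2⟩ := h
  exact ⟨C, h, h1.trans hs, h2.trans hp⟩

lemma Maps.refl (ψ : τ → QState ι) : Maps 0 0 ψ ψ :=
  ⟨⟨[]⟩, fun _ => rfl, le_rfl, le_rfl⟩

lemma Maps.trans {s p s' p' : ℕ} {ψ ψ' ψ'' : τ → QState ι} (h : Maps s p ψ ψ')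
    (h' : Maps s' p' ψ' ψ'') : Maps (s + s') (p + p') ψ ψ'' := by
  obtain ⟨C, h, h1, h2⟩ := h
  obtain ⟨C', h', h1', h2'⟩ := h'
  refine ⟨⟨C.layers ++ C'.layers⟩, fun i => ?_, ?_, ?_⟩
  · rw [← h', ← h]
    simp [Circuit.run]
  · simpa [Circuit.size] using add_le_add h1 h1'
  · simpa [Circuit.depth] using add_le_add h2 h2'

lemma Maps.comp {s p : ℕ} {ψ ψ' : τ → QState ι} (h : Maps s p ψ ψ') (f : υ → τ) :
    Maps s p (fun i => ψ (f i)) (fun i => ψ' (f i)) := by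
  obtain ⟨C, h, h1, h2⟩ := h
  exact ⟨C, fun i => h _, h1, h2⟩

/-- By linearity, a circuit that maps `ψ i` to `ψ' i` treats superpositions accordingly. -/
lemma Maps.sum [Fintype τ] {s p : ℕ} {ψ ψ' : τ → QState ι} (h : Maps s p ψ ψ') (β : τ → ℂ) :
    Maps s p (fun _ : Unit => ∑ i, β i • ψ i) (fun _ => ∑ i, β i • ψ' i) := by
  obtain ⟨C, h, h1, h2⟩ := h
  refine ⟨C, fun _ => ?_, h1, h2⟩
  simp_rw [Circuit.run_eq_runGates, map_sum, map_smul, ← Circuit.run_eq_runGates, h]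

lemma Gate.apply_comm {g h : Gate ι} (hd : Disjoint g.qubits h.qubits) (ψ : QState ι) :
    g.apply (h.apply ψ) = h.apply (g.apply ψ) := by
  rcases g with ⟨i, U⟩ | ⟨c, t, hct⟩ <;> rcases h with ⟨j, V⟩ | ⟨c', t', hct'⟩ <;>
    simp only [Gate.qubits, Set.disjoint_insert_right, Set.mem_insert_iff,
      Set.mem_singleton_iff, Set.disjoint_singleton_right, not_or] at hd <;>
    funext x <;> simp only [Gate.apply]
  · simp only [Finset.mul_sum]
    rw [Finset.sum_comm]
    refine Finset.sum_congr rfl fun a _ => Finset.sum_congr rfl fun b _ => ?_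
    rw [Function.update_of_ne hd, Function.update_of_ne (Ne.symm hd), Function.update_comm hd]
    ring
  · obtain ⟨h1, h2⟩ := hd
    refine Finset.sum_congr rfl fun a _ => ?_
    simp only [Function.update_of_ne h1, Function.update_of_ne h2,
      Function.update_of_ne (Ne.symm h2), Function.update_comm h2]
  · obtain ⟨h1, h2⟩ := hd
    refine Finset.sum_congr rfl fun a _ => ?_
    simp only [Function.update_of_ne (Ne.symm h1), Function.update_of_ne (Ne.symm h2),
      Function.update_of_ne h2, Function.update_comm h2]
  · obtain ⟨⟨h1, h2⟩, h3, h4⟩ := hd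
    simp only [ne_eq, h2, h4, Ne.symm h3, Ne.symm h4, not_false_eq_true,
      Function.update_of_ne]
    rw [Function.update_comm h4]

lemma runGates_comm {l l' : List (Gate ι)}
    (h : ∀ g ∈ l, ∀ g' ∈ l', Disjoint g.qubits g'.qubits) (ψ : QState ι) :
    runGates l (runGates l' ψ) = runGates l' (runGates l ψ) := by
  have key : ∀ (g : Gate ι) (l' : List (Gate ι)), (∀ g' ∈ l', Disjoint g.qubits g'.qubits) →
      ∀ ψ, g.apply (runGates l' ψ) = runGates l' (g.apply ψ) := by
    intro g l' h
    induction l' with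
    | nil => intro ψ; rfl
    | cons a l' ih =>
      intro ψ
      rw [runGates_cons, runGates_cons, ih fun g' hg' => h g' (List.mem_cons_of_mem _ hg'),
        Gate.apply_comm (h a List.mem_cons_self)]
  induction l generalizing ψ with
  | nil => rfl
  | cons a l ih =>
    rw [runGates_cons, runGates_cons, key a l' (h a List.mem_cons_self),
      ih fun g hg => h g (List.mem_cons_of_mem _ hg)]

/-- Gate sequences that act on pairwise disjoint sets of qubits can be executed in parallel: in
layer `k`, each of them executes its `k`-th gate. -/
lemma maps_parallel {ts : List υ} {G : υ → List (Gate ι)} {c : ℕ}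
    (hlen : ∀ t ∈ ts, (G t).length ≤ c)
    (hd : ts.Pairwise fun t u => ∀ g ∈ G t, ∀ h ∈ G u, Disjoint g.qubits h.qubits) :
    Maps (c * ts.length) c (fun ψ : QState ι => ψ) (fun ψ => runGates (ts.flatMap G) ψ) := by
  induction c generalizing G with
  | zero =>
    have : ts.flatMap G = [] := by
      simp only [List.flatMap_eq_nil_iff]
      exact fun t ht => List.length_eq_zero_iff.1 (Nat.le_zero.1 (hlen t ht))
    rw [this, zero_mul]
    exact Maps.refl _
  | succ c ih =>
    have hdis : (ts.flatMap fun t => (G t).take 1).Pairwise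
        fun g h => Disjoint g.qubits h.qubits := by
      rw [List.pairwise_flatMap]
      refine ⟨fun t _ => ?_, hd.imp fun h g hg g' hg' =>
        h g (List.mem_of_mem_take hg) g' (List.mem_of_mem_take hg')⟩
      rcases G t with _ | ⟨g, l⟩ <;> simp
    have hsize : (ts.flatMap fun t => (G t).take 1).length ≤ ts.length := by
      rw [List.length_flatMap]
      calc _ ≤ (ts.map fun _ => 1).sum := List.sum_le_sum fun t _ => by simp
        _ = ts.length := by simp
    have hfirst : Maps ts.length 1 (fun ψ : QState ι => ψ)
        (fun ψ => runGates (ts.flatMap fun t => (G t).take 1) ψ) :=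
      ⟨⟨[⟨_, hdis⟩]⟩, fun ψ => by simp [Circuit.run_eq_runGates],
        by simpa [Circuit.size] using hsize, by simp [Circuit.depth]⟩
    have hrest := ih (G := fun t => (G t).drop 1)
      (fun t ht => by have := hlen t ht; simp; omega)
      (hd.imp fun h g hg g' hg' => h g (List.mem_of_mem_drop hg) g' (List.mem_of_mem_drop hg'))
    have hreorder : ∀ ψ, runGates (ts.flatMap fun t => (G t).drop 1)
        (runGates (ts.flatMap fun t => (G t).take 1) ψ) = runGates (ts.flatMap G) ψ := by
      clear hdis hsize hfirst hrest hlen ih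
      induction ts with
      | nil => intro ψ; rfl
      | cons t ts iht =>
        intro ψ
        rw [List.pairwise_cons] at hd
        simp only [List.flatMap_cons, runGates_append]
        rw [← iht hd.2, ← List.take_append_drop 1 (G t), runGates_append,
          List.take_append_drop 1 (G t)]
        congr 1
        apply runGates_comm
        intro g hg g' hg'
        obtain ⟨u, hu, hgu⟩ := List.mem_flatMap.1 hg'
        exact hd.1 u hu g (List.mem_of_mem_drop hg) g' (List.mem_of_mem_take hgu)
    have := hfirst.trans (hrest.comp _)
    simp only [hreorder] at this
    exact this.mono (by ring_nf; rfl) (by omega)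

lemma maps_gate (g : Gate ι) : Maps 1 1 (fun ψ : QState ι => ψ) (fun ψ => g.apply ψ) :=
  maps_parallel (ts := [()]) (G := fun _ => [g]) (c := 1) (by simp) (by simp)

end Semantics

lemma ket_apply {ι : Type} [Fintype ι] (x y : ι → Fin 2) :
    ket x y = if y = x then 1 else 0 := by
  simp [ket, Pi.single_apply]

/-! ### Action on basis states -/

section Spread

variable {ι : Type} [Fintype ι] [DecidableEq ι]

/-- The product state in which the qubit `t` is in the state `φ` and every other qubit `i` is in
the basis state `|x i⟩`. -/
def spread (x : ι → Fin 2) (t : ι) (φ : Fin 2 → ℂ) : QState ι :=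
  fun y => if Function.update y t (x t) = x then φ (y t) else 0

lemma spread_eq (x : ι → Fin 2) (t : ι) (φ : Fin 2 → ℂ) :
    spread x t φ = φ 0 • ket (Function.update x t 0) + φ 1 • ket (Function.update x t 1) := by
  funext y
  have h : ∀ b, y = Function.update x t b ↔ Function.update y t (x t) = x ∧ y t = b := by
    intro b
    constructor
    · rintro rfl; simp
    · rintro ⟨h, rfl⟩; rw [← h]; simp
  simp only [spread, Pi.add_apply, Pi.smul_apply, ket_apply, h, smul_eq_mul]
  by_cases hy : Function.update y t (x t) = x
  · rcases (by omega : y t = 0 ∨ y t = 1) with h | h <;> simp [hy, h]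
  · simp [hy]

/-- Any qubit of a basis state can be singled out as the target. -/
lemma ket_eq_spread (x : ι → Fin 2) (t : ι) : ket x = spread x t (Pi.single (x t) 1) := by
  rcases (by omega : x t = 0 ∨ x t = 1) with h | h <;>
    · have hx : Function.update x t (x t) = x := by simp
      rw [spread_eq]
      rw [h] at hx ⊢
      simp [hx]

lemma single_apply_spread (x : ι → Fin 2) (t : ι) (φ : Fin 2 → ℂ)
    (U : Matrix.unitaryGroup (Fin 2) ℂ) :
    (Gate.single t U).apply (spread x t φ) =
      spread x t ((U : Matrix (Fin 2) (Fin 2) ℂ).mulVec φ) := by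
  funext y
  simp only [Gate.apply, spread, Function.update_idem, Function.update_self]
  split_ifs <;> simp [Matrix.mulVec, dotProduct]

lemma cnot_apply_spread (x : ι → Fin 2) {c t : ι} (h : c ≠ t) (φ : Fin 2 → ℂ) :
    (Gate.cnot c t h).apply (spread x t φ) = spread x t (fun b => φ (b + x c)) := by
  funext y
  simp only [Gate.apply, spread, Function.update_idem, Function.update_self]
  split_ifs with hy
  · rw [← hy, Function.update_of_ne h]
  · rfl

lemma cnot_apply_ket (x : ι → Fin 2) {c t : ι} (h : c ≠ t) :
    (Gate.cnot c t h).apply (ket x) = ket (Function.update x t (x t + x c)) := by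
  rw [ket_eq_spread x t, cnot_apply_spread, spread_eq]
  rcases (by omega : x t = 0 ∨ x t = 1) with ht | ht <;>
    rcases (by omega : x c = 0 ∨ x c = 1) with hc | hc <;> simp [ht, hc]

lemma single_apply_ket (x : ι → Fin 2) (t : ι) (U : Matrix.unitaryGroup (Fin 2) ℂ) :
    (Gate.single t U).apply (ket x) =
      (U : Matrix (Fin 2) (Fin 2) ℂ) 0 (x t) • ket (Function.update x t 0) +
      (U : Matrix (Fin 2) (Fin 2) ℂ) 1 (x t) • ket (Function.update x t 1) := by
  rw [ket_eq_spread x t, single_apply_spread, spread_eq]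
  simp

/-- The NOT gate, as a unitary matrix. -/
def notU : Matrix.unitaryGroup (Fin 2) ℂ :=
  ⟨!![0, 1; 1, 0], by
    rw [Matrix.mem_unitaryGroup_iff]
    ext i j
    fin_cases i <;> fin_cases j <;> simp [Matrix.mul_apply, Matrix.star_eq_conjTranspose]⟩

lemma not_apply_ket (x : ι → Fin 2) (t : ι) :
    (Gate.single t notU).apply (ket x) = ket (Function.update x t (x t + 1)) := by
  rw [single_apply_ket]
  rcases (by omega : x t = 0 ∨ x t = 1) with ht | ht <;> simp [ht, notU]

/-- The phase gate `diag (1, u)`, as a unitary matrix. -/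
def phaseU (u : ℂ) (hu : ‖u‖ = 1) : Matrix.unitaryGroup (Fin 2) ℂ :=
  ⟨!![1, 0; 0, u], by
    have h : u * (starRingEnd ℂ) u = 1 := by rw [Complex.mul_conj']; simp [hu]
    rw [Matrix.mem_unitaryGroup_iff]
    ext i j
    fin_cases i <;> fin_cases j <;>
      simp [Matrix.mul_apply, Matrix.star_eq_conjTranspose, h]⟩

lemma phase_apply_ket (x : ι → Fin 2) (t : ι) (u : ℂ) (hu : ‖u‖ = 1) :
    (Gate.single t (phaseU u hu)).apply (ket x) = (if x t = 1 then u else 1) • ket x := by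
  rw [single_apply_ket]
  rcases (by omega : x t = 0 ∨ x t = 1) with ht | ht
  · have : Function.update x t 0 = x := by rw [← ht]; simp
    simp [ht, phaseU, this]
  · have : Function.update x t 1 = x := by rw [← ht]; simp
    simp [ht, phaseU, this]

end Spread

/-! ### Gadgets on two and three qubits -/

section Gadgets

variable {ι : Type} [Fintype ι] [DecidableEq ι]

/-- The image of `φ` under the reflection `!![a, b; b, -a]`. -/
def reflect (a b : ℝ) (φ : Fin 2 → ℂ) : Fin 2 → ℂ := ![a * φ 0 + b * φ 1, b * φ 0 - a * φ 1]

/-- A real reflection is conjugate to NOT by a rotation. Hence a CNOT between two one-qubit gates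
is a controlled reflection. -/
lemma exists_conj_not_eq_reflect {a b : ℝ} (ha : 0 ≤ a) (hab : a ^ 2 + b ^ 2 = 1) :
    ∃ V : Matrix.unitaryGroup (Fin 2) ℂ, ∀ φ : Fin 2 → ℂ,
      (V : Matrix (Fin 2) (Fin 2) ℂ).mulVec
        (fun i => ((star V : Matrix.unitaryGroup (Fin 2) ℂ) : Matrix (Fin 2) (Fin 2) ℂ).mulVec φ
          (i + 1)) = reflect a b φ := by
  have hb : -1 ≤ b ∧ b ≤ 1 := by constructor <;> nlinarith [sq_nonneg a]
  -- `p` and `q` are the cosine and sine of an angle, and `b` and `-a` those of its double.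
  obtain ⟨p, q, hp, hq, hpq⟩ : ∃ p q : ℝ, p ^ 2 = (1 + b) / 2 ∧ q ^ 2 = (1 - b) / 2 ∧
      -2 * (p * q) = a := by
    refine ⟨√((1 + b) / 2), -√((1 - b) / 2), Real.sq_sqrt (by linarith), ?_, ?_⟩
    · rw [neg_sq, Real.sq_sqrt (by linarith)]
    · rw [mul_neg, ← Real.sqrt_mul (by linarith),
        show (1 + b) / 2 * ((1 - b) / 2) = (a / 2) ^ 2 by linarith,
        Real.sqrt_sq (by linarith)]
      ring
  have h1 : (p : ℂ) * p + q * q = 1 := by norm_cast; linarith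
  have h2 : -2 * ((p : ℂ) * q) = a := by rw [← hpq]; push_cast; ring
  have h3 : (p : ℂ) * p - q * q = b := by norm_cast; linarith
  refine ⟨⟨!![(p : ℂ), -q; q, p], ?_⟩, fun φ => ?_⟩
  · rw [Matrix.mem_unitaryGroup_iff]
    ext i j
    fin_cases i <;> fin_cases j <;> simp [Matrix.mul_apply, Matrix.star_eq_conjTranspose] <;>
      first | ring1 | linear_combination h1
  · funext i
    rw [reflect, ← h2, ← h3]
    fin_cases i <;>
      simp [Matrix.mulVec, dotProduct] <;> ring

/-- A rotation of `t`, a CNOT from `s` and the inverse rotation reflect `t` under the control of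
`s`. -/
lemma exists_controlled_reflect {s t : ι} (hst : s ≠ t) {a b : ℝ} (ha : 0 ≤ a)
    (hab : a ^ 2 + b ^ 2 = 1) :
    ∃ l : List (Gate ι), l.length = 3 ∧ (∀ g ∈ l, g.qubits ⊆ {s, t}) ∧
      ∀ x φ, runGates l (spread x t φ) = spread x t (if x s = 0 then φ else reflect a b φ) := by
  obtain ⟨V, hV⟩ := exists_conj_not_eq_reflect ha hab
  refine ⟨[.single t (star V), .cnot s t hst, .single t V], rfl, ?_, fun x φ => ?_⟩
  · simp [Gate.qubits]
  · simp only [runGates_cons, runGates_nil, single_apply_spread, cnot_apply_spread]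
    congr 1
    rcases (by omega : x s = 0 ∨ x s = 1) with h | h
    · simp only [h, add_zero, Matrix.mulVec_mulVec, if_true, ← Submonoid.coe_mul]
      rw [Unitary.mul_star_self, OneMemClass.coe_one, Matrix.one_mulVec]
    · simp only [h]
      exact hV φ

/-- A gadget of at most 4 gates that rotates the basis states with `x s = 1`, `x t = 0` to a
superposition of themselves and their swap on `s, t`: the reflection of `t` controlled by `s`
gives `a |1,0⟩ + b |1,1⟩`, and then CNOT clears `s` where `t` is set. -/
lemma exists_split {s t : ι} (hst : s ≠ t) {a b : ℝ} (ha : 0 ≤ a) (hab : a ^ 2 + b ^ 2 = 1) :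
    ∃ l : List (Gate ι), l.length ≤ 4 ∧ (∀ g ∈ l, g.qubits ⊆ {s, t}) ∧
      (∀ x, x s = 0 → x t = 0 → runGates l (ket x) = ket x) ∧
      ∀ x, x s = 1 → x t = 0 → runGates l (ket x) =
        (a : ℂ) • ket x + (b : ℂ) • ket (Function.update (Function.update x s 0) t 1) := by
  obtain ⟨l, hl, hq, hr⟩ := exists_controlled_reflect hst ha hab
  refine ⟨l ++ [.cnot t s hst.symm], by simp [hl], ?_, fun x hs ht => ?_, fun x hs ht => ?_⟩
  · simp only [List.mem_append, List.mem_singleton]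
    rintro g (hg | rfl)
    · exact hq g hg
    · simp [Gate.qubits, Set.pair_comm]
  · rw [runGates_append, ket_eq_spread x t, hr, if_pos hs, ← ket_eq_spread, runGates_cons,
      cnot_apply_ket, ht, add_zero, Function.update_eq_self, runGates_nil]
  · have hx : Function.update x t 0 = x := by rw [← ht]; simp
    have hx' : Function.update x s 1 = x := by rw [← hs]; simp
    have hkx : runGates l (ket x) =
        (a : ℂ) • ket x + (b : ℂ) • ket (Function.update x t 1) := by
      rw [ket_eq_spread x t, hr, if_neg (by simp [hs]), spread_eq, hx, ← ket_eq_spread, ht]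
      simp [reflect]
    rw [runGates_append, hkx, map_add, map_smul, map_smul]
    simp only [runGates_cons, runGates_nil, cnot_apply_ket]
    simp [ht, hst, hs, hx', Function.update_comm hst]

/-- The inverse of the computation of the conjunction of `s` and `y` into `t`, on the states in
which `t` holds this conjunction. When `s` is set, `t` is turned from `|y⟩` to `|0⟩` by a
Hadamard gate, a `Z` gate if `y` is set, and a Hadamard gate; and when `s` is not set, each of the
three controlled reflections fixes `|0⟩`. -/
lemma exists_uncompute_and {s t y : ι} (hst : s ≠ t) (hyt : y ≠ t) :
    ∃ l : List (Gate ι), l.length = 9 ∧ (∀ g ∈ l, g.qubits ⊆ {s, t, y}) ∧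
      ∀ x, x t = x s * x y → runGates l (ket x) = ket (Function.update x t 0) := by
  obtain ⟨r, hr0, hr1⟩ : ∃ r : ℝ, 0 ≤ r ∧ r ^ 2 + r ^ 2 = 1 :=
    ⟨√(1 / 2), Real.sqrt_nonneg _, by rw [Real.sq_sqrt (by norm_num)]; norm_num⟩
  have hC : (r : ℂ) * r + r * r = 1 := by norm_cast; linarith
  obtain ⟨h, hl, hq, hr⟩ := exists_controlled_reflect hst hr0 hr1
  obtain ⟨z, zl, zq, zr⟩ := exists_controlled_reflect hyt zero_le_one (b := 0) (by norm_num)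
  refine ⟨h ++ z ++ h, by simp [hl, zl], ?_, fun x hx => ?_⟩
  · simp only [List.mem_append]
    rintro g ((hg | hg) | hg)
    · exact (hq g hg).trans (by grind)
    · exact (zq g hg).trans (by grind)
    · exact (hq g hg).trans (by grind)
  · rw [runGates_append, runGates_append, ket_eq_spread x t, hr, zr, hr,
      ket_eq_spread (Function.update x t 0) t]
    have : spread (Function.update x t 0) t = spread x t := by
      funext φ
      simp [spread_eq]
    rw [this, hx]
    congr 1
    rcases (by omega : x s = 0 ∨ x s = 1) with hs | hs <;>
      rcases (by omega : x y = 0 ∨ x y = 1) with hy | hy <;>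
      simp [hs, hy, reflect] <;> funext i <;> fin_cases i <;> simp
    · linear_combination hC
    · linear_combination hC

/-- A gadget of at most 11 gates that merges the position `t` of a one-hot encoding into the
position `s`, given a control qubit `y` that has the value `v` if the position is `t`, and the
other value if the position is `s`. -/
lemma exists_merge {s t y : ι} (hst : s ≠ t) (hys : y ≠ s) (hyt : y ≠ t) (v : Fin 2) :
    ∃ l : List (Gate ι), l.length ≤ 11 ∧ (∀ g ∈ l, g.qubits ⊆ {s, t, y}) ∧
      (∀ x, x s = 0 → x t = 0 → runGates l (ket x) = ket x) ∧
      (∀ x, x s = 1 → x t = 0 → x y ≠ v → runGates l (ket x) = ket x) ∧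
      ∀ x, x s = 0 → x t = 1 → x y = v →
        runGates l (ket x) = ket (Function.update (Function.update x s 1) t 0) := by
  obtain ⟨l, hl, hq, hr⟩ := exists_uncompute_and hst hyt
  refine ⟨.cnot t s hst.symm :: (if v = 0 then [.cnot s t hst] else []) ++ l, ?_, ?_, ?_, ?_, ?_⟩
  · split_ifs <;> simp [hl]
  · simp only [List.mem_cons, List.mem_append]
    rintro g ((rfl | hg) | hg)
    · simp only [Gate.qubits]; grind
    · split_ifs at hg
      · obtain rfl := List.mem_singleton.1 hg
        simp only [Gate.qubits]; grind
      · simp at hg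
    · exact hq g hg
  all_goals intro x hs ht
  · have hx : Function.update x s 0 = x := by rw [← hs]; simp
    have hx' : Function.update x t 0 = x := by rw [← ht]; simp
    split_ifs <;>
      simp [runGates_cons, cnot_apply_ket, hs, ht, hx, hx', hr]
  · intro hy
    have hx : Function.update x s 1 = x := by rw [← hs]; simp
    have hx' : Function.update x t 0 = x := by rw [← ht]; simp
    split_ifs with hv
    · have hy : x y = 1 := by omega
      simp [runGates_cons, cnot_apply_ket, hs, ht, hx, hx', hr, hst, hyt, hy]
    · have hy : x y = 0 := by omega
      simp [runGates_cons, cnot_apply_ket, hs, ht, hx, hx', hr, hy]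
  · rintro rfl
    rcases (by omega : x y = 0 ∨ x y = 1) with hy | hy
    · simp only [hy, if_true, List.cons_append, List.nil_append, runGates_cons, cnot_apply_ket]
      rw [hr _ (by simp [hst, hst.symm, hys, hyt, hs, ht, hy])]
      simp [hst.symm, hs, ht]
    · simp only [hy, one_ne_zero, if_false, List.cons_append, List.nil_append, runGates_cons,
        cnot_apply_ket]
      rw [hr _ (by simp [hst.symm, hys, hs, ht, hy])]
      simp [hs, ht]

end Gadgets

/-! ### Pairs of consecutive list elements -/

section Pairs

variable {ι : Type}

/-- Pairs of qubits without any common qubit. -/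
def DisjointPairs (ps : List (ι × ι)) : Prop :=
  (∀ p ∈ ps, p.1 ≠ p.2) ∧
    ps.Pairwise fun p r => Disjoint ({p.1, p.2} : Set ι) {r.1, r.2}

lemma DisjointPairs.fst_ne_snd {ps : List (ι × ι)} (h : DisjointPairs ps) {p r : ι × ι}
    (hp : p ∈ ps) (hr : r ∈ ps) : p.2 ≠ r.1 := by
  by_cases hpr : p = r
  · subst hpr
    exact (h.1 p hp).symm
  · have : Std.Symm fun p r : ι × ι => Disjoint ({p.1, p.2} : Set ι) {r.1, r.2} :=
      ⟨fun _ _ h => h.symm⟩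
    have := h.2.forall hp hr hpr
    rw [Set.disjoint_iff_forall_ne] at this
    exact this (by simp) (by simp)

lemma DisjointPairs.map_swap {ps : List (ι × ι)} (h : DisjointPairs ps) :
    DisjointPairs (ps.map Prod.swap) := by
  refine ⟨fun p hp => ?_, ?_⟩
  · obtain ⟨r, hr, rfl⟩ := List.mem_map.1 hp
    exact (h.1 r hr).symm
  · rw [List.pairwise_map]
    refine h.2.imp fun {p r} h => ?_
    simpa [Set.pair_comm] using h

/-- The pairs of consecutive elements at the positions `2 k` and `2 k + 1` of a list. -/
def pairUp : List ι → List (ι × ι)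
  | a :: b :: l => (a, b) :: pairUp l
  | _ => []

/-- What is left of a list if the first element of each pair in `pairUp` is deleted. -/
def survivors : List ι → List ι
  | _ :: b :: l => b :: survivors l
  | l => l

lemma survivors_sublist : ∀ l : List ι, (survivors l).Sublist l
  | [] => List.Sublist.refl _
  | [_] => List.Sublist.refl _
  | _ :: _ :: l => ((survivors_sublist l).cons_cons _).cons _

lemma two_mul_length_survivors : ∀ l : List ι, 2 * (survivors l).length ≤ l.length + 1
  | [] => by simp [survivors]
  | [_] => by simp [survivors]
  | _ :: _ :: l => by
    have := two_mul_length_survivors l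
    simp [survivors]
    omega

lemma length_pairUp_add : ∀ l : List ι, (pairUp l).length + (survivors l).length = l.length
  | [] => by simp [survivors, pairUp]
  | [_] => by simp [survivors, pairUp]
  | _ :: _ :: l => by
    have := length_pairUp_add l
    simp [survivors, pairUp]
    omega

lemma mem_of_mem_pairUp : ∀ {l : List ι} {p : ι × ι}, p ∈ pairUp l → p.1 ∈ l ∧ p.2 ∈ l
  | [], p, h => by simp [pairUp] at h
  | [_], p, h => by simp [pairUp] at h
  | a :: b :: l, p, h => by
    rcases List.mem_cons.1 h with rfl | h
    · simp
    · have := mem_of_mem_pairUp h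
      simp [this]

lemma disjointPairs_pairUp : ∀ {l : List ι}, l.Nodup → DisjointPairs (pairUp l)
  | [], _ => by simp [pairUp, DisjointPairs]
  | [_], _ => by simp [pairUp, DisjointPairs]
  | a :: b :: l, h => by
    simp only [List.nodup_cons, List.mem_cons, not_or] at h
    obtain ⟨⟨hab, hal⟩, hbl, hl⟩ := h
    have ih := disjointPairs_pairUp hl
    refine ⟨fun p hp => ?_, List.pairwise_cons.2 ⟨fun p hp => ?_, ih.2⟩⟩
    · rcases List.mem_cons.1 hp with rfl | hp
      · exact hab
      · exact ih.1 p hp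
    · obtain ⟨h1, h2⟩ := mem_of_mem_pairUp hp
      rw [Set.disjoint_iff_forall_ne]
      rintro u hu w hw rfl
      simp only [Set.mem_insert_iff, Set.mem_singleton_iff] at hu hw
      rcases hu with rfl | rfl <;> rcases hw with rfl | rfl <;> contradiction

end Pairs

lemma add_self_fin_two {ι : Type} (x : ι → Fin 2) : x + x = 0 := by
  funext i
  have : ∀ b : Fin 2, b + b = 0 := by decide
  exact this _

lemma add_single_eq_update {ι : Type} [DecidableEq ι] (x : ι → Fin 2) (t : ι) (b : Fin 2) :
    x + Pi.single t b = Function.update x t (x t + b) := by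
  funext k
  by_cases hk : k = t
  · subst hk; simp
  · simp [hk]

/-! ### Layers of CNOT gates as additive maps -/

section Xor

variable {ι : Type} [DecidableEq ι]

/-- The bits that CNOT gates with the pairs `(control, target)` in `ps` add to the bits `x`. -/
def xorDiff (ps : List (ι × ι)) (x : ι → Fin 2) : ι → Fin 2 :=
  (ps.map fun p => Pi.single p.2 (x p.1)).sum

lemma xorDiff_cons (p : ι × ι) (ps : List (ι × ι)) (x : ι → Fin 2) :
    xorDiff (p :: ps) x = Pi.single p.2 (x p.1) + xorDiff ps x := by
  simp [xorDiff]

lemma xorDiff_add (ps : List (ι × ι)) (x y : ι → Fin 2) :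
    xorDiff ps (x + y) = xorDiff ps x + xorDiff ps y := by
  induction ps with
  | nil => simp [xorDiff]
  | cons p ps ih =>
    simp only [xorDiff_cons, ih, Pi.add_apply, Pi.single_add]
    abel

lemma xorDiff_eq_zero {ps : List (ι × ι)} {x : ι → Fin 2} (h : ∀ p ∈ ps, x p.1 = 0) :
    xorDiff ps x = 0 := by
  induction ps with
  | nil => simp [xorDiff]
  | cons p ps ih =>
    rw [xorDiff_cons, ih fun p' hp' => h p' (List.mem_cons_of_mem _ hp'), h p List.mem_cons_self]
    simp

lemma xorDiff_apply_eq_zero {ps : List (ι × ι)} {k : ι} (h : ∀ p ∈ ps, p.2 ≠ k)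
    (x : ι → Fin 2) : xorDiff ps x k = 0 := by
  induction ps with
  | nil => simp [xorDiff]
  | cons p ps ih =>
    rw [xorDiff_cons, Pi.add_apply, ih fun p' hp' => h p' (List.mem_cons_of_mem _ hp')]
    simp [(h p List.mem_cons_self).symm]

lemma DisjointPairs.xorDiff_xorDiff {ps : List (ι × ι)} (h : DisjointPairs ps) (x : ι → Fin 2) :
    xorDiff ps (xorDiff ps x) = 0 :=
  xorDiff_eq_zero fun _ hp => xorDiff_apply_eq_zero (fun _ hr => h.fst_ne_snd hr hp) x

/-- After the first element of each pair has been added to the second, the survivors have the same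
parity as the whole list. -/
lemma sum_survivors : ∀ {l : List ι}, l.Nodup → ∀ x : ι → Fin 2,
    ((survivors l).map (x + xorDiff (pairUp l) x)).sum = (l.map x).sum
  | [], _, x => by simp [survivors]
  | [_], _, x => by simp [survivors, pairUp, xorDiff]
  | a :: b :: l, h, x => by
    simp only [List.nodup_cons, List.mem_cons, not_or] at h
    obtain ⟨⟨hab, hal⟩, hbl, hl⟩ := h
    have ih := sum_survivors hl x
    have hb : xorDiff (pairUp l) x b = 0 :=
      xorDiff_apply_eq_zero (fun p hp (hpb : p.2 = b) => hbl (hpb ▸ (mem_of_mem_pairUp hp).2)) x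
    have hrest : (survivors l).map (x + xorDiff ((a, b) :: pairUp l) x) =
        (survivors l).map (x + xorDiff (pairUp l) x) := by
      refine List.map_congr_left fun k hk => ?_
      have : k ≠ b := fun hkb => hbl (hkb ▸ (survivors_sublist l).subset hk)
      simp [xorDiff_cons, this]
    simp only [survivors, pairUp, List.map_cons, List.sum_cons, hrest, ih]
    simp only [xorDiff_cons, Pi.add_apply, Pi.single_eq_same, hb]
    abel

/-- If a bit `c` has been added to the survivors, adding the second element of each pair to the
first extends this to the whole list. -/
lemma xorDiff_swap_survivors : ∀ {l : List ι}, l.Nodup → ∀ c : Fin 2,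
    ((survivors l).map fun i => Pi.single i c).sum + xorDiff ((pairUp l).map Prod.swap)
      ((survivors l).map fun i => Pi.single i c).sum = (l.map fun i => Pi.single i c).sum
  | [], _, c => by simp [survivors, pairUp, xorDiff]
  | [_], _, c => by simp [survivors, pairUp, xorDiff]
  | a :: b :: l, h, c => by
    simp only [List.nodup_cons, List.mem_cons, not_or] at h
    obtain ⟨⟨hab, hal⟩, hbl, hl⟩ := h
    have ih := xorDiff_swap_survivors hl c
    have hb : ∀ l' : List ι, b ∉ l' → (l'.map fun i => (Pi.single i c : ι → Fin 2)).sum b = 0 := by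
      intro l' hl'
      induction l' with
      | nil => simp
      | cons k l' ih =>
        simp only [List.mem_cons, not_or] at hl'
        simp [ih hl'.2, hl'.1]
    have hz : xorDiff ((pairUp l).map Prod.swap) (Pi.single b c) = 0 := by
      refine xorDiff_eq_zero fun p hp => ?_
      obtain ⟨r, hr, rfl⟩ := List.mem_map.1 hp
      have : r.2 ≠ b := fun hrb => hbl (hrb ▸ (mem_of_mem_pairUp hr).2)
      simp [this]
    simp only [survivors, pairUp, List.map_cons, List.sum_cons, xorDiff_cons, xorDiff_add, hz,
      Pi.single_eq_same, Pi.single_zero, zero_add,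
      hb _ fun h => hbl ((survivors_sublist l).subset h), ← ih, add_zero, Prod.swap_prod_mk]
    abel

end Xor

/-! ### Parity and fan-out trees -/

section Trees

variable {ι : Type} [Fintype ι] [DecidableEq ι]

lemma maps_cnotLayer {ps : List (ι × ι)} (h : DisjointPairs ps) :
    Maps ps.length 1 (fun x => ket x) (fun x => ket (x + xorDiff ps x)) := by
  let G : ι × ι → List (Gate ι) := fun p => if hp : p.1 ≠ p.2 then [.cnot p.1 p.2 hp] else []
  have hG : ∀ p, ∀ g ∈ G p, g.qubits = {p.1, p.2} := by
    intro p g hg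
    simp only [G] at hg
    split_ifs at hg
    · obtain rfl := List.mem_singleton.1 hg
      rfl
    · simp at hg
  have := maps_parallel (ts := ps) (G := G) (c := 1)
    (fun p _ => by simp only [G]; split_ifs <;> simp)
    (h.2.imp fun {p r} hpr g hg g' hg' => by rwa [hG p g hg, hG r g' hg'])
  convert (this.comp fun x : ι → Fin 2 => ket x) using 1
  · rw [one_mul]
  · funext x
    clear this
    induction ps generalizing x with
    | nil => simp [xorDiff]
    | cons p ps ih =>
      have hp := h.1 p List.mem_cons_self
      have h' : DisjointPairs ps :=
        ⟨fun p hp => h.1 p (List.mem_cons_of_mem _ hp), (List.pairwise_cons.1 h.2).2⟩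
      simp only [List.flatMap_cons, G, dif_pos hp, runGates_append, runGates_cons, runGates_nil,
        cnot_apply_ket, ← add_single_eq_update]
      rw [← ih h', xorDiff_add, xorDiff_cons, xorDiff_eq_zero (x := Pi.single p.2 (x p.1))]
      · congr 1
        abel
      · intro r hr
        simp [(h.fst_ne_snd (p := p) (r := r) List.mem_cons_self
          (List.mem_cons_of_mem _ hr)).symm]

/-- The parity of `l` is added to the qubit `y` by a tree of CNOT gates of logarithmic depth: add
the first element of each pair to the second, add the parity of the survivors to `y`, and repeat
the first step in order to undo it. -/
lemma maps_parity (k : ℕ) {l : List ι} {y : ι} (hl : l.Nodup) (hy : y ∉ l)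
    (hk : l.length ≤ 2 ^ k) :
    Maps (2 * l.length) (2 * k + 1) (fun x => ket x)
      (fun x => ket (x + Pi.single y (l.map x).sum)) := by
  induction k generalizing l with
  | zero =>
    rcases l with _ | ⟨a, l⟩
    · simpa using (Maps.refl (ι := ι) fun x => ket x).mono (Nat.zero_le _) (Nat.zero_le _)
    · obtain rfl : l = [] := by
        simpa using hk
      have hay : a ≠ y := fun h => hy (by simp [h])
      have := maps_cnotLayer (ps := [(a, y)]) ⟨by simpa using hay, by simp⟩
      simpa [xorDiff] using this.mono (s' := 2) (by simp) le_rfl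
  | succ k ih =>
    have hD := disjointPairs_pairUp hl
    have h1 := maps_cnotLayer hD
    have hs := survivors_sublist l
    have hc := two_mul_length_survivors l
    have hc' := length_pairUp_add l
    have h2 := ih (hl.sublist hs) (fun h => hy (hs.subset h)) (by rw [pow_succ] at hk; omega)
    have h3 := (h1.trans (h2.comp _)).trans (h1.comp _)
    have hy0 : ∀ c, xorDiff (pairUp l) (Pi.single y c) = 0 := fun c =>
      xorDiff_eq_zero fun p hp => by
        have : p.1 ≠ y := fun h => hy (h ▸ (mem_of_mem_pairUp hp).1)
        simp [this]
    have h4 : ∀ x : ι → Fin 2, ∀ c, x + xorDiff (pairUp l) x + Pi.single y c +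
        xorDiff (pairUp l) (x + xorDiff (pairUp l) x + Pi.single y c) = x + Pi.single y c := by
      intro x c
      rw [xorDiff_add, xorDiff_add, hD.xorDiff_xorDiff, hy0, add_zero, add_zero,
        add_right_comm, add_assoc _ (xorDiff _ _) (xorDiff _ _), add_self_fin_two, add_zero]
    simp only [sum_survivors hl, h4] at h3
    refine h3.mono ?_ (by omega)
    rcases Nat.eq_zero_or_pos (pairUp l).length with h0 | h0 <;> omega

/-- The qubit `y` is added to all qubits in `l` by a tree of CNOT gates of logarithmic depth, the
transpose of the tree for parities. -/
lemma maps_fanout (k : ℕ) {l : List ι} {y : ι} (hl : l.Nodup) (hy : y ∉ l)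
    (hk : l.length ≤ 2 ^ k) :
    Maps (2 * l.length) (2 * k + 1) (fun x => ket x)
      (fun x => ket (x + (l.map fun i => Pi.single i (x y)).sum)) := by
  induction k generalizing l with
  | zero =>
    rcases l with _ | ⟨a, l⟩
    · simpa using (Maps.refl (ι := ι) fun x => ket x).mono (Nat.zero_le _) (Nat.zero_le _)
    · obtain rfl : l = [] := by
        simpa using hk
      have hay : a ≠ y := fun h => hy (by simp [h])
      have := maps_cnotLayer (ps := [(y, a)]) ⟨by simpa using hay.symm, by simp⟩
      simpa [xorDiff] using this.mono (s' := 2) (by simp) le_rfl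
  | succ k ih =>
    have hD := (disjointPairs_pairUp hl).map_swap
    have h1 := maps_cnotLayer hD
    have hs := survivors_sublist l
    have hc := two_mul_length_survivors l
    have hc' := length_pairUp_add l
    have h2 := ih (hl.sublist hs) (fun h => hy (hs.subset h)) (by rw [pow_succ] at hk; omega)
    have h3 := (h1.trans (h2.comp _)).trans (h1.comp _)
    have hy0 : ∀ x, xorDiff ((pairUp l).map Prod.swap) x y = 0 :=
      xorDiff_apply_eq_zero fun p hp h => by
        obtain ⟨r, hr, rfl⟩ := List.mem_map.1 hp
        exact hy (h ▸ (mem_of_mem_pairUp hr).1)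
    have h4 : ∀ x z : ι → Fin 2, x + xorDiff ((pairUp l).map Prod.swap) x + z +
        xorDiff ((pairUp l).map Prod.swap) (x + xorDiff ((pairUp l).map Prod.swap) x + z) =
          x + (z + xorDiff ((pairUp l).map Prod.swap) z) := by
      intro x z
      rw [xorDiff_add, xorDiff_add, hD.xorDiff_xorDiff, add_zero]
      generalize xorDiff ((pairUp l).map Prod.swap) x = u
      calc x + u + z + (u + xorDiff _ z) = x + (z + xorDiff _ z) + (u + u) := by abel
        _ = _ := by rw [add_self_fin_two, add_zero]
    simp only [h4, Pi.add_apply, hy0, add_zero, xorDiff_swap_survivors hl] at h3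
    refine h3.mono ?_ (by omega)
    rw [List.length_map]
    rcases Nat.eq_zero_or_pos (pairUp l).length with h0 | h0 <;> omega

end Trees

/-! ### The trie of the bit strings -/

section Prefix

variable {n d : ℕ}

/-- The least index of a bit string that has the same first `k` bits as the bit string `q i`. The
values of `rep q k` are the nodes at depth `k` of the binary trie of the bit strings. -/
def rep (q : Fin d → Fin n → Fin 2) (k : ℕ) (i : Fin d) : Fin d :=
  (Finset.univ.filter fun i' => ∀ j : Fin n, j.val < k → q i' j = q i j).min' ⟨i, by simp⟩

variable (q : Fin d → Fin n → Fin 2) {k : ℕ} {i i' : Fin d}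

lemma apply_rep (i : Fin d) {j : Fin n} (hj : j.val < k) : q (rep q k i) j = q i j := by
  have h := Finset.min'_mem (Finset.univ.filter fun i' => ∀ j : Fin n, j.val < k → q i' j = q i j)
    ⟨i, by simp⟩
  exact (Finset.mem_filter.1 h).2 j hj

variable {q}

lemma rep_le (h : ∀ j : Fin n, j.val < k → q i' j = q i j) : rep q k i ≤ i' :=
  Finset.min'_le _ _ (by simpa using h)

lemma rep_congr (h : ∀ j : Fin n, j.val < k → q i j = q i' j) : rep q k i = rep q k i' :=
  le_antisymm (rep_le fun j hj => (apply_rep q i' hj).trans (h j hj).symm)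
    (rep_le fun j hj => (apply_rep q i hj).trans (h j hj))

lemma rep_rep_of_le {k' : ℕ} (h : k ≤ k') (i : Fin d) : rep q k (rep q k' i) = rep q k i :=
  rep_congr fun _ hj => apply_rep q i (hj.trans_le h)

lemma rep_succ_rep (i : Fin d) : rep q (k + 1) (rep q k i) = rep q k i :=
  le_antisymm (rep_le fun _ _ => rfl) (rep_le fun _ hj =>
    (apply_rep q _ (hj.trans (Nat.lt_succ_self k))).trans (apply_rep q i hj))

lemma rep_zero (hd : 0 < d) (i : Fin d) : rep q 0 i = ⟨0, hd⟩ :=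
  le_antisymm (rep_le fun _ hj => absurd hj (Nat.not_lt_zero _)) (Nat.zero_le _)

lemma rep_length (hq : Function.Injective q) (i : Fin d) : rep q n i = i :=
  hq (funext fun j => apply_rep q i j.2)

variable (q k) in
/-- The nodes `t` at depth `k + 1` of the trie that do not represent their parent node
`rep q k t`. -/
def newNodes : List (Fin d) :=
  (List.finRange d).filter fun t => rep q (k + 1) t = t ∧ rep q k t ≠ t

lemma nodup_newNodes : (newNodes q k).Nodup := (List.nodup_finRange d).filter _

lemma length_newNodes_le : (newNodes q k).length ≤ d :=
  (List.length_filter_le _ _).trans (by simp)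

lemma mem_newNodes {t : Fin d} : t ∈ newNodes q k ↔ rep q (k + 1) t = t ∧ rep q k t ≠ t := by
  simp [newNodes]

lemma rep_notMem_newNodes (i : Fin d) : rep q k i ∉ newNodes q k := fun h =>
  (mem_newNodes.1 h).2 (rep_rep_of_le le_rfl i)

/-- The bit `k` tells a new node at depth `k + 1` from the sibling that represents their parent. -/
lemma apply_rep_ne (hk : k < n) {t : Fin d} (ht : t ∈ newNodes q k) :
    q (rep q k t) ⟨k, hk⟩ ≠ q t ⟨k, hk⟩ := by
  intro h
  obtain ⟨h1, h2⟩ := mem_newNodes.1 ht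
  have : rep q (k + 1) (rep q k t) = rep q (k + 1) t := by
    refine rep_congr fun j hj => ?_
    rcases Nat.lt_succ_iff_lt_or_eq.1 hj with hj | rfl
    · exact apply_rep q t hj
    · exact h
  rw [rep_succ_rep, h1] at this
  exact h2 this

/-- A node of a binary trie has at most one new child. -/
lemma rep_injOn_newNodes (hk : k < n) {t u : Fin d} (ht : t ∈ newNodes q k)
    (hu : u ∈ newNodes q k) (h : rep q k t = rep q k u) : t = u := by
  have h1 := apply_rep_ne hk ht
  have h2 := apply_rep_ne hk hu
  rw [h] at h1
  have h3 : q t ⟨k, hk⟩ = q u ⟨k, hk⟩ := by omega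
  rw [← (mem_newNodes.1 ht).1, ← (mem_newNodes.1 hu).1]
  refine rep_congr fun j hj => ?_
  rcases Nat.lt_succ_iff_lt_or_eq.1 hj with hj | rfl
  · rw [← apply_rep q t hj, h, apply_rep q u hj]
  · exact h3

/-- Moving along `f` at the nodes in `ts`. -/
def moveAlong (f : Fin d → Fin d) (ts : List (Fin d)) (r : Fin d) : Fin d :=
  if r ∈ ts then f r else r

/-- At the positions that the trie has at depth `k + 1`, a step towards the root is a move along the
new nodes. -/
lemma moveAlong_rep (i : Fin d) :
    moveAlong (rep q k) (newNodes q k) (rep q (k + 1) i) = rep q k i := by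
  unfold moveAlong
  split_ifs with h
  · exact rep_rep_of_le (Nat.le_succ k) i
  · rw [mem_newNodes, rep_rep_of_le le_rfl, rep_rep_of_le (Nat.le_succ k)] at h
    by_contra h'
    exact h ⟨rfl, Ne.symm h'⟩

lemma moveAlong_cons {f : Fin d → Fin d} {t : Fin d} {ts : List (Fin d)} (ht : t ∉ ts)
    (hf : ∀ u ∈ ts, f u ≠ t) (r : Fin d) :
    moveAlong f (t :: ts) r = if moveAlong f ts r = t then f t else moveAlong f ts r := by
  unfold moveAlong
  by_cases hr : r ∈ ts
  · simp [hr, hf r hr]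
  · by_cases hrt : r = t <;> simp [hr, hrt]
    simp [ht]

lemma moveAlong_eq_iff {f : Fin d → Fin d} {ts : List (Fin d)} {t : Fin d} (ht : t ∉ ts)
    (hf : ∀ u ∈ ts, f u ≠ t) (r : Fin d) : moveAlong f ts r = t ↔ r = t := by
  unfold moveAlong
  split_ifs with h
  · exact ⟨fun h' => absurd h' (hf r h), fun h' => absurd (h' ▸ h) ht⟩
  · rfl

end Prefix

/-! ### The qubits of the circuit -/

section Register

variable {n d : ℕ}

/-- The `j`-th data qubit. -/
def dataQ (d : ℕ) {n : ℕ} (j : Fin n) : Fin n ⊕ Fin (d + d) := Sum.inl j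

/-- The ancilla qubit that marks the node `i` of the trie. -/
def nodeQ (n : ℕ) {d : ℕ} (i : Fin d) : Fin n ⊕ Fin (d + d) := Sum.inr (Fin.castAdd d i)

/-- The ancilla qubit that holds a copy of a data qubit for the use of the node `i`. -/
def copyQ (n : ℕ) {d : ℕ} (i : Fin d) : Fin n ⊕ Fin (d + d) := Sum.inr (Fin.natAdd d i)

/-- The bits with the values `x`, `e` and `c` of the data, node and copy qubits. -/
def bits (x : Fin n → Fin 2) (e c : Fin d → Fin 2) : Fin n ⊕ Fin (d + d) → Fin 2 :=
  Sum.elim x (Fin.append e c)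

variable (x : Fin n → Fin 2) (e c : Fin d → Fin 2)

@[simp] lemma bits_dataQ (j : Fin n) : bits x e c (dataQ d j) = x j := rfl

@[simp] lemma bits_nodeQ (i : Fin d) : bits x e c (nodeQ n i) = e i := Fin.append_left e c i

@[simp] lemma bits_copyQ (i : Fin d) : bits x e c (copyQ n i) = c i := Fin.append_right e c i

lemma register_cases {P : Fin n ⊕ Fin (d + d) → Prop} (h1 : ∀ j, P (dataQ d j))
    (h2 : ∀ i, P (nodeQ n i)) (h3 : ∀ i, P (copyQ n i)) : ∀ k, P k := by
  rintro (j | k)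
  · exact h1 j
  · exact Fin.addCases h2 h3 k

@[simp] lemma dataQ_inj {j j' : Fin n} : dataQ d j = dataQ d j' ↔ j = j' := by simp [dataQ]

@[simp] lemma nodeQ_inj {i i' : Fin d} : nodeQ n i = nodeQ n i' ↔ i = i' := by simp [nodeQ]

@[simp] lemma copyQ_inj {i i' : Fin d} : copyQ n i = copyQ n i' ↔ i = i' := by simp [copyQ]

@[simp] lemma dataQ_ne_nodeQ (j : Fin n) (i : Fin d) : dataQ d j ≠ nodeQ n i := by
  simp [dataQ, nodeQ]

@[simp] lemma dataQ_ne_copyQ (j : Fin n) (i : Fin d) : dataQ d j ≠ copyQ n i := by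
  simp [dataQ, copyQ]

@[simp] lemma copyQ_ne_nodeQ (i i' : Fin d) : copyQ n i ≠ nodeQ n i' := by
  simp only [copyQ, nodeQ, ne_eq, Sum.inr.injEq, Fin.ext_iff, Fin.val_natAdd, Fin.val_castAdd]
  omega

@[simp] lemma nodeQ_ne_copyQ (i i' : Fin d) : nodeQ n i ≠ copyQ n i' := (copyQ_ne_nodeQ i' i).symm

lemma bits_update_dataQ (j : Fin n) (b : Fin 2) :
    Function.update (bits x e c) (dataQ d j) b = bits (Function.update x j b) e c := by
  funext k
  revert k
  apply register_cases <;> intro k <;> simp [Function.update_apply, (dataQ_ne_nodeQ _ _).symm,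
    (dataQ_ne_copyQ _ _).symm]

lemma bits_update_nodeQ (i : Fin d) (b : Fin 2) :
    Function.update (bits x e c) (nodeQ n i) b = bits x (Function.update e i b) c := by
  funext k
  revert k
  apply register_cases <;> intro k <;> simp [Function.update_apply]

lemma bits_add_copies (b : Fin 2) :
    bits x e c + (((List.finRange d).map (copyQ n)).map fun k => Pi.single k b).sum =
      bits x e (c + fun _ => b) := by
  rw [List.map_map, ← Fin.sum_univ_def]
  funext k
  revert k
  apply register_cases <;> intro k <;>
    simp [Finset.sum_apply, Pi.single_apply]

lemma ket_bits_zero : ket (bits x (0 : Fin d → Fin 2) 0) = tensor (ket x) (ket 0) := by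
  funext y
  have : y = bits x (0 : Fin d → Fin 2) 0 ↔
      (fun i => y (Sum.inl i)) = x ∧ (fun j => y (Sum.inr j)) = 0 := by
    constructor
    · rintro rfl
      refine ⟨rfl, funext fun j => ?_⟩
      refine Fin.addCases (fun i => ?_) (fun i => ?_) j
      · exact bits_nodeQ x 0 0 i
      · exact bits_copyQ x 0 0 i
    · rintro ⟨h1, h2⟩
      funext k
      revert k
      apply register_cases <;> intro k <;> simp
      · exact congrFun h1 k
      · exact congrFun h2 _
      · exact congrFun h2 _
  simp only [ket_apply, tensor, this]
  split_ifs <;> simp_all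

lemma update_single_self (r : Fin d) :
    Function.update (Pi.single r 1 : Fin d → Fin 2) r 0 = 0 := by
  rw [Pi.single, Function.update_idem]
  exact Function.update_eq_self r 0

end Register

/-! ### Preparation of the one-hot encoding -/

section OneHot

variable {n d : ℕ}

/-- The total weight of the indices with `g i = r`. -/
noncomputable def fiberWeight (p : Fin d → ℝ) (g : Fin d → Fin d) (r : Fin d) : ℝ :=
  ∑ i, if g i = r then p i else 0

/-- The superposition of the one-hot basis states of the nodes `r`, where the probability of `r`
is the total weight of the indices with `g i = r`. -/
noncomputable def fiberState (n : ℕ) (p : Fin d → ℝ) (g : Fin d → Fin d) :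
    QState (Fin n ⊕ Fin (d + d)) :=
  ∑ r, ((√(fiberWeight p g r) : ℝ) : ℂ) • ket (bits 0 (Pi.single r 1) 0)

lemma fiberWeight_nonneg {p : Fin d → ℝ} (hp : ∀ i, 0 ≤ p i) (g : Fin d → Fin d) (r : Fin d) :
    0 ≤ fiberWeight p g r :=
  Finset.sum_nonneg fun i _ => by split_ifs <;> simp [hp]

/-- A gadget that splits the weight `u + v` of a node `s` into a weight `u` of `s` and a weight
`v` of `t`. -/
lemma exists_split_weight {s t : Fin d} (hst : s ≠ t) {u v : ℝ} (hu : 0 ≤ u) (hv : 0 ≤ v) :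
    ∃ l : List (Gate (Fin n ⊕ Fin (d + d))), l.length ≤ 4 ∧
      (∀ g ∈ l, g.qubits ⊆ {nodeQ n s, nodeQ n t}) ∧
      ∀ p g, fiberWeight p g s = u → fiberWeight p g t = v →
        runGates l (fiberState n p fun i => if g i = t then s else g i) = fiberState n p g := by
  obtain ⟨a, b, ha, hab, hau, hbv⟩ : ∃ a b : ℝ, 0 ≤ a ∧ a ^ 2 + b ^ 2 = 1 ∧
      √(u + v) * a = √u ∧ √(u + v) * b = √v := by
    -- The reflection turns `|0⟩` to `(√u |0⟩ + √v |1⟩) / √(u + v)`; it is arbitrary if `u + v = 0`.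
    rcases eq_or_lt_of_le (add_nonneg hu hv) with h | h
    · have hu0 : u = 0 := by linarith
      have hv0 : v = 0 := by linarith
      exact ⟨1, 0, by simp [hu0, hv0]⟩
    · have h' : √(u + v) ≠ 0 := (Real.sqrt_pos.2 h).ne'
      refine ⟨√u / √(u + v), √v / √(u + v), by positivity, ?_, mul_div_cancel₀ _ h',
        mul_div_cancel₀ _ h'⟩
      rw [div_pow, div_pow, Real.sq_sqrt hu, Real.sq_sqrt hv, Real.sq_sqrt h.le, ← add_div,
        div_self h.ne']
  obtain ⟨l, hl, hq, h0, h1⟩ := exists_split (s := nodeQ n s) (t := nodeQ n t) (by simpa) ha hab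
  refine ⟨l, hl, hq, fun p g hgu hgv => ?_⟩
  set g' : Fin d → Fin d := fun i => if g i = t then s else g i with hg'
  have ht : fiberWeight p g' t = 0 := by
    refine Finset.sum_eq_zero fun i _ => if_neg ?_
    simp only [hg']
    split_ifs with h
    exacts [hst, h]
  have hs : fiberWeight p g' s = u + v := by
    rw [← hgu, ← hgv, fiberWeight, fiberWeight, fiberWeight, ← Finset.sum_add_distrib]
    refine Finset.sum_congr rfl fun i _ => ?_
    by_cases h : g i = t
    · simp [hg', h, hst.symm]
    · simp [hg', h]
  have hr : ∀ r, r ≠ s → r ≠ t → fiberWeight p g' r = fiberWeight p g r := by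
    intro r hrs hrt
    refine Finset.sum_congr rfl fun i _ => ?_
    by_cases h : g i = t
    · simp [hg', h, hrs.symm, hrt.symm]
    · simp [hg', h]
  have htm : t ∈ Finset.univ.erase s := by simp [hst.symm]
  have hmove : Function.update (Function.update (Pi.single s 1 : Fin d → Fin 2) s 0) t 1 =
      Pi.single t 1 := by
    rw [update_single_self]
    rfl
  have hsplit : runGates l (ket (bits 0 (Pi.single s 1) 0)) =
      (a : ℂ) • ket (bits 0 (Pi.single s 1) 0) + (b : ℂ) • ket (bits 0 (Pi.single t 1) 0) := by
    rw [h1 _ (by simp) (by simp [hst.symm]), bits_update_nodeQ, bits_update_nodeQ, hmove]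
  simp only [fiberState, map_sum, map_smul]
  rw [← Finset.add_sum_erase _ _ (Finset.mem_univ s), ← Finset.add_sum_erase _ _ htm,
    ← Finset.add_sum_erase _ _ (Finset.mem_univ s), ← Finset.add_sum_erase _ _ htm, ← add_assoc,
    ← add_assoc]
  congr 1
  · rw [hsplit, ht, hs, hgu, hgv, smul_add, smul_smul, smul_smul, ← Complex.ofReal_mul,
      ← Complex.ofReal_mul, hau, hbv]
    simp
  · refine Finset.sum_congr rfl fun r hr' => ?_
    simp only [Finset.mem_erase, Finset.mem_univ, and_true] at hr'
    rw [hr r hr'.2 hr'.1, h0 _ (by simp [Ne.symm hr'.2]) (by simp [Ne.symm hr'.1])]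

/-- The weights of all nodes at depth `k` of the trie are split between their children in
parallel. -/
lemma maps_split_level (q : Fin d → Fin n → Fin 2) {p : Fin d → ℝ} (hp : ∀ i, 0 ≤ p i) {k : ℕ}
    (hk : k < n) :
    Maps (4 * d) 4 (fun _ : Unit => fiberState n p (rep q k))
      (fun _ => fiberState n p (rep q (k + 1))) := by
  have key : ∀ t, ∃ l : List (Gate (Fin n ⊕ Fin (d + d))), l.length ≤ 4 ∧
      (∀ g ∈ l, g.qubits ⊆ {nodeQ n (rep q k t), nodeQ n t}) ∧
      (rep q k t ≠ t → ∀ g, fiberWeight p g (rep q k t) =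
          fiberWeight p (rep q (k + 1)) (rep q k t) →
        fiberWeight p g t = fiberWeight p (rep q (k + 1)) t →
        runGates l (fiberState n p fun i => if g i = t then rep q k t else g i) =
          fiberState n p g) := by
    intro t
    by_cases ht : rep q k t = t
    · exact ⟨[], by simp, by simp, fun h => absurd ht h⟩
    · obtain ⟨l, h1, h2, h3⟩ := exists_split_weight (n := n) ht (fiberWeight_nonneg hp _ _)
        (fiberWeight_nonneg hp _ _)
      exact ⟨l, h1, h2, fun _ g => h3 p g⟩
  choose G hlen hqub hG using key
  have hpar := maps_parallel (ts := newNodes q k) (G := G) (fun t _ => hlen t) <| by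
    refine nodup_newNodes.imp_of_mem fun {t u} ht hu htu g hg g' hg' => ?_
    refine Set.disjoint_of_subset (hqub t g hg) (hqub u g' hg') ?_
    have h1 : rep q k t ≠ rep q k u := fun h => htu (rep_injOn_newNodes hk ht hu h)
    have h2 : rep q k t ≠ u := fun h => rep_notMem_newNodes (q := q) t (h ▸ hu)
    have h3 : t ≠ rep q k u := fun h => rep_notMem_newNodes (q := q) u (h ▸ ht)
    simp [h1.symm, h2.symm, h3.symm, htu.symm]
  have hrun : ∀ ts : List (Fin d), ts.Nodup → (∀ t ∈ ts, t ∈ newNodes q k) →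
      runGates (ts.flatMap G)
        (fiberState n p fun i => moveAlong (rep q k) ts (rep q (k + 1) i)) =
      fiberState n p (rep q (k + 1)) := by
    intro ts
    induction ts with
    | nil => intro _ _; simp [moveAlong]
    | cons t ts ih =>
      intro hnd hts
      rw [List.nodup_cons] at hnd
      have ht := hts t List.mem_cons_self
      have hts' : ∀ u ∈ ts, u ∈ newNodes q k := fun u hu => hts u (List.mem_cons_of_mem _ hu)
      have hne : ∀ u ∈ ts, rep q k u ≠ t := fun u hu h =>
        rep_notMem_newNodes (q := q) u (h ▸ ht)
      have hs : rep q k t ∉ ts := fun h => rep_notMem_newNodes (q := q) t (hts' _ h)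
      have hne' : ∀ u ∈ ts, rep q k u ≠ rep q k t := fun u hu h =>
        hnd.1 (rep_injOn_newNodes hk (hts' u hu) ht h ▸ hu)
      -- The moves along `ts` do not change which indices lie at `t` or at its parent, so that the
      -- gadget of `t` finds the weights for which it is made.
      rw [List.flatMap_cons, runGates_append, ← ih hnd.2 hts']
      congr 1
      simp only [moveAlong_cons hnd.1 hne]
      refine hG t (mem_newNodes.1 ht).2 _ ?_ ?_
      · simp only [fiberWeight, moveAlong_eq_iff hs hne']
      · simp only [fiberWeight, moveAlong_eq_iff hnd.1 hne]
  have := (hpar.comp fun _ : Unit => fiberState n p (rep q k)).mono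
    (Nat.mul_le_mul_left 4 length_newNodes_le) le_rfl
  convert this using 2
  have := hrun _ nodup_newNodes fun _ h => h
  simp only [moveAlong_rep] at this
  exact this.symm

lemma maps_phases (u : Fin d → ℂ) (hu : ∀ i, ‖u i‖ = 1) :
    Maps d 1 (fun i => ket (bits (0 : Fin n → Fin 2) (Pi.single i 1) 0))
      (fun i => u i • ket (bits (0 : Fin n → Fin 2) (Pi.single i 1) 0)) := by
  let G : Fin d → List (Gate (Fin n ⊕ Fin (d + d))) := fun i =>
    [.single (nodeQ n i) (phaseU (u i) (hu i))]
  have hpar := maps_parallel (ts := List.finRange d) (G := G) (c := 1) (by simp [G]) <| by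
    refine (List.nodup_finRange d).imp fun {t v} htv => ?_
    simpa [G, Gate.qubits] using htv.symm
  have := hpar.comp fun i : Fin d => ket (bits (0 : Fin n → Fin 2) (Pi.single i 1) 0)
  rw [List.length_finRange, one_mul] at this
  convert this using 2 with i
  have hrun : ∀ ts : List (Fin d), ts.Nodup →
      runGates (ts.flatMap G) (ket (bits (0 : Fin n → Fin 2) (Pi.single i 1) 0)) =
        (if i ∈ ts then u i else 1) • ket (bits (0 : Fin n → Fin 2) (Pi.single i 1) 0) := by
    intro ts
    induction ts with
    | nil => simp
    | cons t ts ih =>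
      intro hnd
      rw [List.nodup_cons] at hnd
      simp only [List.flatMap_cons, G, List.singleton_append, runGates_cons, phase_apply_ket,
        map_smul] at ih ⊢
      rw [ih hnd.2]
      by_cases hti : i = t
      · subst hti
        simp [hnd.1]
      · simp [hti, Ne.symm hti]
  simp [hrun _ (List.nodup_finRange d)]

lemma exists_phase (z : ℂ) : ∃ u : ℂ, ‖u‖ = 1 ∧ (‖z‖ : ℂ) * u = z :=
  ⟨Complex.exp (z.arg * Complex.I), Complex.norm_exp_ofReal_mul_I _,
    Complex.norm_mul_exp_arg_mul_I z⟩

/-- Preparation of the one-hot encoding of the amplitudes. -/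
lemma maps_oneHot (hd : 0 < d) {α : Fin d → ℂ} {q : Fin d → Fin n → Fin 2}
    (hq : Function.Injective q) (hα : ∑ i, ‖α i‖ ^ 2 = 1) :
    Maps (1 + n * (4 * d) + d) (1 + n * 4 + 1)
      (fun _ : Unit => ket (bits (0 : Fin n → Fin 2) (0 : Fin d → Fin 2) 0))
      (fun _ => ∑ i, α i • ket (bits (0 : Fin n → Fin 2) (Pi.single i 1) 0)) := by
  choose u hu hαu using fun i => exists_phase (α i)
  have hinit : Maps 1 1 (fun _ : Unit => ket (bits (0 : Fin n → Fin 2) (0 : Fin d → Fin 2) 0))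
      (fun _ => fiberState n (fun i => ‖α i‖ ^ 2) (rep q 0)) := by
    convert (maps_gate (Gate.single (nodeQ n ⟨0, hd⟩) notU)).comp
      fun _ : Unit => ket (bits (0 : Fin n → Fin 2) (0 : Fin d → Fin 2) 0) using 2
    rw [not_apply_ket, bits_update_nodeQ, bits_nodeQ, fiberState,
      Finset.sum_eq_single ⟨0, hd⟩]
    · simp only [fiberWeight, rep_zero hd, if_true, hα]
      simp [Pi.single]
    · intro r _ hr
      simp [fiberWeight, rep_zero hd, hr.symm]
    · simp
  have hlevels : ∀ k ≤ n, Maps (k * (4 * d)) (k * 4)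
      (fun _ : Unit => fiberState n (fun i => ‖α i‖ ^ 2) (rep q 0))
      (fun _ => fiberState n (fun i => ‖α i‖ ^ 2) (rep q k)) := by
    intro k
    induction k with
    | zero => intro _; simpa using Maps.refl _
    | succ k ih =>
      intro hk
      refine ((ih (by omega)).trans (maps_split_level q (fun i => by positivity) hk)).mono
        (le_of_eq (by ring)) (le_of_eq (by ring))
  have hend : fiberState n (fun i => ‖α i‖ ^ 2) (rep q n) =
      ∑ i, (‖α i‖ : ℂ) • ket (bits (0 : Fin n → Fin 2) (Pi.single i 1) 0) := by
    refine Finset.sum_congr rfl fun r _ => ?_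
    simp [fiberWeight, rep_length hq]
  have := (hinit.trans (hlevels n le_rfl)).trans
    (hend ▸ (maps_phases (n := n) u hu).sum fun i => (‖α i‖ : ℂ))
  simpa only [smul_smul, hαu] using this

end OneHot

/-! ### From the one-hot encoding to the bit strings -/

section Decode

variable {n d : ℕ}

lemma list_sum_single {l : List (Fin d)} (hl : l.Nodup) (i : Fin d) :
    (l.map (Pi.single i 1 : Fin d → Fin 2)).sum = if i ∈ l then 1 else 0 := by
  induction l with
  | nil => simp
  | cons a l ih =>
    rw [List.nodup_cons] at hl
    rw [List.map_cons, List.sum_cons, ih hl.2]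
    by_cases h : i = a
    · subst h; simp [hl.1]
    · simp [h, Ne.symm h]

/-- The bit strings are computed from the one-hot encoding: each of their bits is a parity of node
qubits. -/
lemma maps_write (q : Fin d → Fin n → Fin 2) {m : ℕ} (hm : d ≤ 2 ^ m) :
    Maps (n * (2 * d)) (n * (2 * m + 1))
      (fun i => ket (bits (0 : Fin n → Fin 2) (Pi.single i 1 : Fin d → Fin 2) 0))
      (fun i => ket (bits (q i) (Pi.single i 1 : Fin d → Fin 2) 0)) := by
  suffices h : ∀ k ≤ n, Maps (k * (2 * d)) (k * (2 * m + 1))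
      (fun i => ket (bits (0 : Fin n → Fin 2) (Pi.single i 1 : Fin d → Fin 2) 0))
      (fun i => ket (bits (fun j : Fin n => if j.val < k then q i j else 0)
        (Pi.single i 1 : Fin d → Fin 2) 0)) by
    simpa using h n le_rfl
  intro k
  induction k with
  | zero =>
    intro _
    rw [zero_mul, zero_mul]
    exact Maps.refl _
  | succ k ih =>
    intro hk
    let l := (List.finRange d).filter fun i => q i ⟨k, hk⟩ = 1
    have hl : l.Nodup := (List.nodup_finRange d).filter _
    have hlen : l.length ≤ d := (List.length_filter_le _ _).trans (by simp)
    have h := maps_parity m (l := l.map (nodeQ n)) (y := dataQ d ⟨k, hk⟩)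
      (hl.map fun _ _ => nodeQ_inj.1) (by simp [(dataQ_ne_nodeQ _ _).symm]) (by simp; omega)
    rw [List.length_map] at h
    have := ((ih (by omega)).trans (h.comp _)).mono (s' := (k + 1) * (2 * d))
      (p' := (k + 1) * (2 * m + 1)) (by nlinarith) (le_of_eq (by ring))
    convert this using 3 with i
    have hsum : ((l.map (nodeQ n)).map (bits (fun j : Fin n => if j.val < k then q i j else 0)
        (Pi.single i 1 : Fin d → Fin 2) 0)).sum = q i ⟨k, hk⟩ := by
      have : bits (fun j : Fin n => if j.val < k then q i j else 0)
          (Pi.single i 1 : Fin d → Fin 2) 0 ∘ nodeQ n = Pi.single i 1 := by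
        funext r; simp
      rw [List.map_map, this, list_sum_single hl]
      simp only [l, List.mem_filter, List.mem_finRange, true_and, decide_eq_true_eq]
      split_ifs <;> omega
    rw [hsum, add_single_eq_update, bits_update_dataQ, bits_dataQ]
    congr 1
    funext j
    by_cases hj : j = ⟨k, hk⟩
    · subst hj; simp
    · have hj' : j.val ≠ k := fun h => hj (Fin.ext h)
      rw [Function.update_of_ne hj]
      refine if_congr ?_ rfl rfl
      omega

/-- The position of the one-hot encoding moves from the nodes at depth `k + 1` of the trie to
their parents. The bit `k` of the bit string decides between the two children of a node, and
is copied to all nodes beforehand, so that they can be treated in parallel. -/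
lemma maps_merge_level (q : Fin d → Fin n → Fin 2) {m : ℕ} (hm : d ≤ 2 ^ m) {k : ℕ}
    (hk : k < n) :
    Maps (15 * d) (4 * m + 13)
      (fun i => ket (bits (q i) (Pi.single (rep q (k + 1) i) 1) (0 : Fin d → Fin 2)))
      (fun i => ket (bits (q i) (Pi.single (rep q k i) 1) (0 : Fin d → Fin 2))) := by
  have hfan : Maps (2 * d) (2 * m + 1)
      (fun y : (Fin n → Fin 2) × (Fin d → Fin 2) × (Fin d → Fin 2) => ket (bits y.1 y.2.1 y.2.2))
      (fun y => ket (bits y.1 y.2.1 (y.2.2 + fun _ => y.1 ⟨k, hk⟩))) := by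
    have := maps_fanout m (l := (List.finRange d).map (copyQ n)) (y := dataQ d ⟨k, hk⟩)
      ((List.nodup_finRange d).map fun _ _ => copyQ_inj.1)
      (by simp [(dataQ_ne_copyQ _ _).symm]) (by simpa)
    rw [List.length_map, List.length_finRange] at this
    simpa only [bits_add_copies, bits_dataQ] using this.comp
      fun y : (Fin n → Fin 2) × (Fin d → Fin 2) × (Fin d → Fin 2) => bits y.1 y.2.1 y.2.2
  have key : ∀ t, ∃ l : List (Gate (Fin n ⊕ Fin (d + d))), l.length ≤ 11 ∧
      (∀ g ∈ l, g.qubits ⊆ {nodeQ n (rep q k t), nodeQ n t, copyQ n t}) ∧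
      (rep q k t ≠ t → ∀ x c r, (r = t → c t = q t ⟨k, hk⟩) →
        (r = rep q k t → c t ≠ q t ⟨k, hk⟩) →
        runGates l (ket (bits x (Pi.single r 1) c)) =
          ket (bits x (Pi.single (if r = t then rep q k t else r) 1) c)) := by
    intro t
    by_cases ht : rep q k t = t
    · exact ⟨[], by simp, by simp, fun h => absurd ht h⟩
    · obtain ⟨l, h1, h2, h3, h4, h5⟩ := exists_merge (s := nodeQ n (rep q k t)) (t := nodeQ n t)
        (y := copyQ n t) (by simpa) (by simp) (by simp) (q t ⟨k, hk⟩)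
      refine ⟨l, h1, h2, fun _ x c r hr hr' => ?_⟩
      by_cases hrt : r = t
      · subst hrt
        rw [if_pos rfl, h5 _ (by simp [ht]) (by simp) (by simpa using hr rfl),
          bits_update_nodeQ, bits_update_nodeQ, Function.update_comm ht, update_single_self]
        rfl
      · rw [if_neg hrt]
        by_cases hrs : r = rep q k t
        · exact h4 _ (by simp [hrs]) (by simp [Ne.symm hrt]) (by simpa using hr' hrs)
        · exact h3 _ (by simp [Ne.symm hrs]) (by simp [Ne.symm hrt])
  choose G hlen hqub hG using key
  have hpar := maps_parallel (ts := newNodes q k) (G := G) (fun t _ => hlen t) <| by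
    refine nodup_newNodes.imp_of_mem fun {t u} ht hu htu g hg g' hg' => ?_
    refine Set.disjoint_of_subset (hqub t g hg) (hqub u g' hg') ?_
    have h1 : rep q k t ≠ rep q k u := fun h => htu (rep_injOn_newNodes hk ht hu h)
    have h2 : rep q k t ≠ u := fun h => rep_notMem_newNodes (q := q) t (h ▸ hu)
    have h3 : t ≠ rep q k u := fun h => rep_notMem_newNodes (q := q) u (h ▸ ht)
    simp [h1.symm, h2.symm, h3.symm, htu.symm]
  have hrun : ∀ (x : Fin n → Fin 2) (c : Fin d → Fin 2) (ts : List (Fin d)), ts.Nodup →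
      (∀ t ∈ ts, t ∈ newNodes q k) → ∀ r,
      (∀ t ∈ ts, (r = t → c t = q t ⟨k, hk⟩) ∧ (r = rep q k t → c t ≠ q t ⟨k, hk⟩)) →
      runGates (ts.flatMap G) (ket (bits x (Pi.single r 1) c)) =
        ket (bits x (Pi.single (moveAlong (rep q k) ts r) 1) c) := by
    intro x c ts
    induction ts with
    | nil => intros; simp [moveAlong]
    | cons t ts ih =>
      intro hnd hts r hr
      rw [List.nodup_cons] at hnd
      have ht := hts t List.mem_cons_self
      have hts' : ∀ u ∈ ts, u ∈ newNodes q k := fun u hu => hts u (List.mem_cons_of_mem _ hu)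
      have hr' : ∀ u ∈ ts, _ := fun u hu => hr u (List.mem_cons_of_mem _ hu)
      have hrt := hr t List.mem_cons_self
      rw [List.flatMap_cons, runGates_append, hG t (mem_newNodes.1 ht).2 x c r hrt.1 hrt.2]
      split_ifs with h
      · -- The position has moved to the parent of `t`, and no other pair of nodes contains it.
        have hs : rep q k t ∉ ts := fun h => rep_notMem_newNodes (q := q) t (hts' _ h)
        have hpre : ∀ u ∈ ts, (rep q k t = u → c u = q u ⟨k, hk⟩) ∧
            (rep q k t = rep q k u → c u ≠ q u ⟨k, hk⟩) := fun u hu =>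
          ⟨fun h' => absurd (h' ▸ hu) hs, fun h' =>
            absurd (rep_injOn_newNodes hk ht (hts' u hu) h' ▸ hu) hnd.1⟩
        rw [ih hnd.2 hts' _ hpre]
        simp [moveAlong, h, hs]
      · rw [ih hnd.2 hts' r hr']
        simp [moveAlong, h]
  have hmerge : Maps (11 * d) 11
      (fun i => ket (bits (q i) (Pi.single (rep q (k + 1) i) 1) fun _ : Fin d => q i ⟨k, hk⟩))
      (fun i => ket (bits (q i) (Pi.single (rep q k i) 1) fun _ : Fin d => q i ⟨k, hk⟩)) := by
    have := (hpar.comp fun i => ket (bits (q i) (Pi.single (rep q (k + 1) i) 1)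
      fun _ : Fin d => q i ⟨k, hk⟩)).mono (Nat.mul_le_mul_left 11 length_newNodes_le) le_rfl
    convert this using 2 with i
    rw [hrun _ _ _ nodup_newNodes (fun _ h => h), moveAlong_rep]
    have hi : q (rep q (k + 1) i) ⟨k, hk⟩ = q i ⟨k, hk⟩ := apply_rep q i (Nat.lt_succ_self k)
    intro t ht
    rw [← hi]
    refine ⟨fun h => by rw [h], fun h => ?_⟩
    rw [h]
    exact apply_rep_ne hk ht
  have h1 := hfan.comp fun i => (q i, (Pi.single (rep q (k + 1) i) 1, (0 : Fin d → Fin 2)))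
  have h2 := hfan.comp fun i =>
    (q i, (Pi.single (rep q k i) 1, (fun _ => q i ⟨k, hk⟩ : Fin d → Fin 2)))
  simp only [zero_add, add_self_fin_two] at h1 h2
  exact ((h1.trans hmerge).trans h2).mono (by omega) (by omega)

/-- The one-hot encoding is erased, by moving its position to the root of the trie. -/
lemma maps_erase (hd : 0 < d) {q : Fin d → Fin n → Fin 2} (hq : Function.Injective q) {m : ℕ}
    (hm : d ≤ 2 ^ m) :
    Maps (n * (15 * d) + 1) (n * (4 * m + 13) + 1)
      (fun i => ket (bits (q i) (Pi.single i 1) (0 : Fin d → Fin 2)))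
      (fun i => ket (bits (q i) 0 (0 : Fin d → Fin 2))) := by
  have h : ∀ k ≤ n, Maps (k * (15 * d)) (k * (4 * m + 13))
      (fun i => ket (bits (q i) (Pi.single (rep q k i) 1) (0 : Fin d → Fin 2)))
      (fun i => ket (bits (q i) (Pi.single (rep q 0 i) 1) (0 : Fin d → Fin 2))) := by
    intro k
    induction k with
    | zero => intro _; simpa using Maps.refl _
    | succ k ih =>
      intro hk
      refine ((maps_merge_level q hm hk).trans (ih (by omega))).mono
        (le_of_eq (by ring)) (le_of_eq (by ring))
  have hn := h n le_rfl
  simp only [rep_length hq, rep_zero hd] at hn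
  have hlast := (maps_gate (Gate.single (nodeQ n ⟨0, hd⟩) notU)).comp fun i =>
    ket (bits (q i) (Pi.single ⟨0, hd⟩ 1) (0 : Fin d → Fin 2))
  simp only [not_apply_ket, bits_update_nodeQ, bits_nodeQ, Pi.single_eq_same] at hlast
  convert hn.trans hlast using 4
  exact (update_single_self _).symm

end Decode

end SQSP

theorem theorem1 :
    ∃ K : ℕ, ∀ n d : ℕ, 0 < n → 0 < d → d ≤ 2 ^ n →
      ∀ (α : Fin d → ℂ) (q : Fin d → (Fin n → Fin 2)),
        Function.Injective q → ∑ i, ‖α i‖ ^ 2 = 1 →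
          ∃ m : ℕ, m ≤ K * d ∧
            ∃ C : SQSP.Circuit (Fin n ⊕ Fin m),
              C.Prepares (SQSP.sparseState α q) ∧
              C.size ≤ K * (d * n) ∧
              (C.depth : ℝ) ≤ K * (n * max 1 (Real.logb 2 d)) := by
  -- Size: `1 + 4dn + d` for the one-hot encoding, `2dn` for writing, and `15dn + 1` for erasing.
  refine ⟨40, fun n d hn hd _ α q hq hα => ⟨d + d, by omega, ?_⟩⟩
  have hm : d ≤ 2 ^ Nat.clog 2 d := Nat.le_pow_clog one_lt_two d
  obtain ⟨C, hC, hsize, hdepth⟩ := (SQSP.maps_oneHot hd hq hα).trans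
    (((SQSP.maps_write q hm).trans (SQSP.maps_erase hd hq hm)).sum α)
  refine ⟨C, ?_, ?_, ?_⟩
  · have := hC ()
    simp only [SQSP.ket_bits_zero] at this
    rw [SQSP.Circuit.Prepares, this]
    funext y
    simp [SQSP.sparseState, SQSP.tensor, Finset.sum_mul, mul_assoc]
  · have : 1 ≤ d * n := Nat.mul_pos hd hn
    have : d ≤ d * n := Nat.le_mul_of_pos_right d hn
    calc C.size ≤ _ := hsize
      _ = 21 * (d * n) + d + 2 := by ring
      _ ≤ 40 * (d * n) := by omega
  · have hlog : (Nat.clog 2 d : ℝ) ≤ Real.logb 2 d + 1 := by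
      have h := Nat.ceil_lt_add_one (Real.logb_nonneg one_lt_two (Nat.one_le_cast.2 hd))
      have h' := Real.natCeil_logb_natCast 2 d
      rw [Nat.cast_ofNat] at h'
      rw [h'] at h
      exact h.le
    have h1 := le_max_left 1 (Real.logb 2 d)
    have h2 := le_max_right 1 (Real.logb 2 d)
    set L := max 1 (Real.logb 2 d)
    have hn1 : (1 : ℝ) ≤ n := Nat.one_le_cast.2 hn
    have hdepth' : (C.depth : ℝ) ≤ n * (6 * Nat.clog 2 d + 18) + 3 := by
      have : C.depth ≤ n * (6 * Nat.clog 2 d + 18) + 3 := hdepth.trans (by ring_nf; rfl)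
      exact_mod_cast this
    have h3 : (6 * Nat.clog 2 d + 18 : ℝ) ≤ 30 * L := by linarith
    have h4 : 1 ≤ n * L := one_le_mul_of_one_le_of_one_le hn1 h1
    calc (C.depth : ℝ) ≤ n * (6 * Nat.clog 2 d + 18) + 3 := hdepth'
      _ ≤ n * (30 * L) + 3 * (n * L) := by gcongr; linarith
      _ ≤ (40 : ℕ) * (n * L) := by push_cast; linarith
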